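/- Let $q$ be a prime power, let $V$ be an $n$-dimensional vector space over $\mathbb{F}_q$, and let ${V\brack k}$ denote the set of all $k$-dimensional subspaces of $V$. A family $\mathcal{F}$ of subspaces of $V$ is called $r$-wise $t$-intersecting if $\dim\left(\bigcap_{i=1}^r F_i\right)\ge t$ for all (not necessarily distinct) $F_1,\dots,F_r\in\mathcal{F}$. An $(r+1,t)$-simplex is a set $\{F_1,\dots,F_{r+1}\}$ of $r+1$ distinct subspaces which is $r$-wise $t$-intersecting and satisfies $\dim\left(\bigcap_{i=1}^{r+1}F_i\right)<t$. Let $\mathcal{N}(\Delta_{r+1,t},\mathcal{F})$ denote the number of $(r+1)$-subsets of $\mathcal{F}$ that are $(r+1,t)$-simplices. For a subspace $X\subseteq V$ put \[ \mathcal{F}_{X,k}=\left\{F\in{V\brack k}:\dim(F\cap X)\ge\dim(X)-1\right\},\qquad \mathcal{F}^*_{X,k}=\left\{F\in{V\brack k}:\dim(F\cap X)=\dim(X)-1\right\}, \] and let $n_{t+r,k}=\mathcal{N}(\Delta_{r+1,t},\mathcal{F}_{X_0,k})$, where $X_0$ is any $(r+t)$-dimensional subspace of $V$. **Theorem 1.1.**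 Let $t\ge 1$, $r\ge 2$, $k\ge r+t-1$ and $n\ge 3kr^2+3krt$ be integers, and let $\mathcal{F}\subseteq{V\brack k}$ be an $r$-wise $t$-intersecting family. Then $(r+t)$-dimensional subspaces of $V$ exist, and for each choice of the $(r+t)$-dimensional subspace $X_0$ in the definition of $n_{t+r,k}$, \[ \mathcal{N}(\Delta_{r+1,t},\mathcal{F})\le n_{t+r,k}, \] with equality if and only if $\mathcal{F}^*_{X,k}\subseteq\mathcal{F}\subseteq\mathcal{F}_{X,k}$ for some $(r+t)$-dimensional subspace $X$ of $V$. -/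

import Mathlib

open Module

section SubspaceFamilies

variable {K V : Type*} [Field K] [AddCommGroup V] [Module K V]

/-- A family of subspaces is `k`-uniform if all its members have dimension `k`. -/
def IsUniformFamily (k : ℕ) (F : Set (Submodule K V)) : Prop :=
  ∀ A ∈ F, finrank K A = k

/-- A family of subspaces is `r`-wise `t`-intersecting if any `r` members
(not necessarily distinct) meet in dimension at least `t`. -/
def IsWiseIntersecting (r t : ℕ) (F : Set (Submodule K V)) : Prop :=
  ∀ f : Fin r → Submodule K V, (∀ i, f i ∈ F) →
    t ≤ finrank K (⨅ i, f i : Submodule K V)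

/-- An `(r+1,t)`-simplex: a set of `r+1` distinct subspaces which is `r`-wise `t`-intersecting,
while all the `r+1` subspaces together meet in dimension less than `t`. -/
def IsSimplex (r t : ℕ) (S : Finset (Submodule K V)) : Prop :=
  S.card = r + 1 ∧ IsWiseIntersecting r t (S : Set (Submodule K V)) ∧
    finrank K (S.inf id : Submodule K V) < t

/-- The number of `(r+1)`-subsets of `F` that are `(r+1,t)`-simplices. (Over a finite field and in
finite dimension there are finitely many subspaces, so the set counted here is finite.) -/
noncomputable def simplexCount (r t : ℕ) (F : Set (Submodule K V)) : ℕ :=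
  Set.ncard {S : Finset (Submodule K V) | (S : Set (Submodule K V)) ⊆ F ∧ IsSimplex r t S}

/-- The family of the `k`-subspaces `A` with `dim (A ∩ X) ≥ dim X - 1`. -/
def nearFamily (X : Submodule K V) (k : ℕ) : Set (Submodule K V) :=
  {A | finrank K A = k ∧ finrank K X ≤ finrank K (A ⊓ X : Submodule K V) + 1}

/-- The family of the `k`-subspaces `A` with `dim (A ∩ X) = dim X - 1`. -/
def nearFamilyStar (X : Submodule K V) (k : ℕ) : Set (Submodule K V) :=
  {A | finrank K A = k ∧ finrank K (A ⊓ X : Submodule K V) + 1 = finrank K X}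

end SubspaceFamilies

/-! ### Dimension arithmetic in a finite-dimensional space -/

section Dimension

variable {K V : Type*} [Field K] [AddCommGroup V] [Module K V] [FiniteDimensional K V]

/-! Put `p = r + t - 2`, and let `N₁`, `N₂` count the `k`-spaces above a space of dimension `p + 1`,
`p + 2`; since `n` is large, `N₁` far exceeds `N₂`. If the family has a simplex, no `t`-space lies
in all its members, and this turns `r`-wise `t`-intersection into pairwise `p`-intersection
(`IsWiseIntersecting.two`). Then every member contains one of at most `q ^ (k * (p + 1))` spaces of
dimension `p + 1` (`exists_covering_system`), which bounds the family in terms of `N₁`, and its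
light members in terms of `N₂`.

If each simplex has a light member, there are too few simplices (`simplexCount_le_of_mem`,
`pow_le_simplexCount_nearFamily`, `light_mul_pow_lt`). Otherwise some simplex has only heavy
members. A heavy `(p + 1)`-space meets every member in dimension at least `p`, and two such spaces
from that simplex span an `X` of dimension `r + t` with the whole family inside `nearFamily X k`
(`exists_subset_nearFamily`).

For equality, simplices of `nearFamily X k` use only members of `nearFamilyStar X k`, and each of
those members occurs in a simplex. -/

theorem exists_between_finrank_eq {S A : Submodule K V} (hSA : S ≤ A) {d : ℕ}
    (hS : finrank K S ≤ d) (hA : d ≤ finrank K A) :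
    ∃ B : Submodule K V, S ≤ B ∧ B ≤ A ∧ finrank K B = d := by
  induction d, hS using Nat.le_induction with
  | base => exact ⟨S, le_rfl, hSA, rfl⟩
  | succ d _ ih =>
    obtain ⟨B, hSB, hBA, hB⟩ := ih (by omega)
    obtain ⟨v, hvA, hvB⟩ : ∃ v ∈ A, v ∉ B := by
      by_contra! h
      have := Submodule.finrank_mono (show A ≤ B from h)
      omega
    refine ⟨B ⊔ Submodule.span K {v}, hSB.trans le_sup_left,
      sup_le hBA ((Submodule.span_singleton_le_iff_mem v A).2 hvA), ?_⟩
    rw [Submodule.finrank_sup_span_singleton hvB, hB]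

theorem exists_mem_notMem_of_finrank_lt {A B : Submodule K V} (h : finrank K B < finrank K A) :
    ∃ v ∈ A, v ∉ B := by
  by_contra! h'
  have := Submodule.finrank_mono (show A ≤ B from h')
  omega

theorem exists_mem_mem_notMem_of_finrank_inf_lt {A T U : Submodule K V}
    (h : finrank K (T ⊓ U : Submodule K V) < finrank K (A ⊓ U : Submodule K V)) :
    ∃ g ∈ U, g ∉ T ∧ g ∈ A := by
  obtain ⟨v, ⟨hvA, hvU⟩, hv⟩ := exists_mem_notMem_of_finrank_lt h
  exact ⟨v, hvU, fun hT => hv ⟨hT, hvU⟩, hvA⟩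

/-- A hyperplane of `X` avoiding a prescribed nonzero vector. -/
theorem exists_hyperplane_notMem {X : Submodule K V} {w : V} (hwX : w ∈ X) (hw : w ≠ 0) :
    ∃ H ≤ X, finrank K H + 1 = finrank K X ∧ w ∉ H := by
  obtain ⟨Q, hQ⟩ := Submodule.exists_isCompl (Submodule.span K {w})
  have hwle : Submodule.span K {w} ≤ X := (Submodule.span_singleton_le_iff_mem w X).2 hwX
  have hnot : w ∉ Q ⊓ X := fun h =>
    hw (Submodule.disjoint_def.1 hQ.disjoint w (Submodule.mem_span_singleton_self w) h.1)
  refine ⟨Q ⊓ X, inf_le_right, ?_, hnot⟩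
  rw [← Submodule.finrank_sup_span_singleton hnot, sup_comm, ← sup_inf_assoc_of_le Q hwle,
    hQ.sup_eq_top, top_inf_eq]

theorem exists_linearEquiv_map_eq {S S' : Submodule K V} (h : finrank K S = finrank K S') :
    ∃ e : V ≃ₗ[K] V, S.map (e : V →ₗ[K] V) = S' := by
  obtain ⟨e, he⟩ := Submodule.exists_linearEquiv_restrict_eq (LinearEquiv.ofFinrankEq S S' h)
  refine ⟨e, ?_⟩
  ext x
  constructor
  · rintro ⟨y, hy, rfl⟩
    have := he ⟨y, hy⟩
    simp only [LinearEquiv.coe_coe]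
    rw [← this]
    exact Subtype.prop _
  · intro hx
    refine ⟨(LinearEquiv.ofFinrankEq S S' h).symm ⟨x, hx⟩, Subtype.prop _, ?_⟩
    simp only [LinearEquiv.coe_coe]
    rw [← he]
    simp

/-- Two hyperplanes `T₁`, `T₂` of `T₁ ⊔ T₂` that `U` meets almost fully: either `U` contains a
hyperplane of `T₁ ⊔ T₂`, or it meets `T₁ ⊔ T₂` exactly in `T₁ ⊓ T₂`. -/
theorem finrank_inf_sup_or_inf_sup_eq {p : ℕ} {T₁ T₂ U : Submodule K V}
    (h₁₂ : finrank K (T₁ ⊓ T₂ : Submodule K V) = p)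
    (hU₁ : p ≤ finrank K (U ⊓ T₁ : Submodule K V)) (hU₂ : p ≤ finrank K (U ⊓ T₂ : Submodule K V)) :
    p + 1 ≤ finrank K (U ⊓ (T₁ ⊔ T₂) : Submodule K V) ∨ U ⊓ (T₁ ⊔ T₂) = T₁ ⊓ T₂ := by
  by_cases h : p + 1 ≤ finrank K (U ⊓ (T₁ ⊔ T₂) : Submodule K V)
  · exact Or.inl h
  right
  have e₁ : U ⊓ T₁ = U ⊓ (T₁ ⊔ T₂) :=
    Submodule.eq_of_le_of_finrank_le (inf_le_inf_left U le_sup_left) (by omega)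
  have e₂ : U ⊓ T₂ = U ⊓ (T₁ ⊔ T₂) :=
    Submodule.eq_of_le_of_finrank_le (inf_le_inf_left U le_sup_right) (by omega)
  have hle : U ⊓ (T₁ ⊔ T₂) ≤ T₁ ⊓ T₂ :=
    le_inf (e₁ ▸ inf_le_right) (e₂ ▸ inf_le_right)
  refine Submodule.eq_of_le_of_finrank_le hle ?_
  rw [h₁₂, ← e₁]
  exact hU₁

end Dimension

/-! ### Subspaces above a given one -/

section SubspacesAbove

variable {K V : Type*} [Field K] [AddCommGroup V] [Module K V]

/-- The `k`-dimensional subspaces containing `T`. -/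
def subspacesAbove (k : ℕ) (T : Submodule K V) : Set (Submodule K V) :=
  {A | finrank K A = k ∧ T ≤ A}

theorem subspacesAbove_map (k : ℕ) (e : V ≃ₗ[K] V) (T : Submodule K V) :
    subspacesAbove k (T.map (e : V →ₗ[K] V)) =
      Submodule.map (e : V →ₗ[K] V) '' subspacesAbove k T := by
  ext A
  constructor
  · rintro ⟨hA, hTA⟩
    refine ⟨A.comap (e : V →ₗ[K] V), ⟨?_, Submodule.map_le_iff_le_comap.1 hTA⟩,
      Submodule.map_comap_eq_of_surjective e.surjective A⟩
    rw [← hA, ← LinearEquiv.finrank_map_eq e, Submodule.map_comap_eq_of_surjective e.surjective]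
  · rintro ⟨B, ⟨hB, hTB⟩, rfl⟩
    exact ⟨(LinearEquiv.finrank_map_eq e B).trans hB, Submodule.map_mono hTB⟩

variable [FiniteDimensional K V]

/-- Linear automorphisms act transitively on subspaces of a given dimension. This is what makes `N₁`
and `N₂` single numbers. -/
theorem ncard_subspacesAbove_eq (k : ℕ) {S T : Submodule K V} (h : finrank K S = finrank K T) :
    (subspacesAbove k S).ncard = (subspacesAbove k T).ncard := by
  obtain ⟨e, rfl⟩ := exists_linearEquiv_map_eq h
  rw [subspacesAbove_map, Set.ncard_image_of_injective _ (Submodule.map_injective_of_injective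
    e.injective)]

end SubspacesAbove

/-! ### Counting over a finite field -/

section Counting

theorem ncard_submodule {K V : Type*} [Field K] [AddCommGroup V] [Module K V]
    [FiniteDimensional K V] (S : Submodule K V) :
    (S : Set V).ncard = Nat.card K ^ finrank K S := by
  rw [← Nat.card_coe_set_eq]
  exact Module.natCard_eq_pow_finrank (K := K) (V := S)

theorem Set.ncard_le_ncard_mul {α β : Type*} [Finite α] [Finite β] {s : Set α} {I : Set β}
    (f : β → Set α) {m : ℕ} (h : ∀ a ∈ s, ∃ i ∈ I, a ∈ f i) (hm : ∀ i ∈ I, (f i).ncard ≤ m) :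
    s.ncard ≤ I.ncard * m := by
  classical
  have hI : I.Finite := I.toFinite
  calc s.ncard ≤ (⋃ i ∈ hI.toFinset, f i).ncard := by
        refine Set.ncard_le_ncard (fun a ha => ?_) (Set.toFinite _)
        obtain ⟨i, hi, hai⟩ := h a ha
        simp only [Set.mem_iUnion]
        exact ⟨i, hI.mem_toFinset.2 hi, hai⟩
    _ ≤ ∑ i ∈ hI.toFinset, (f i).ncard := Finset.set_ncard_biUnion_le _ _
    _ ≤ ∑ i ∈ hI.toFinset, m := Finset.sum_le_sum fun i hi => hm i (hI.mem_toFinset.1 hi)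
    _ = I.ncard * m := by
        rw [Finset.sum_const, smul_eq_mul, Set.ncard_eq_toFinset_card I hI]

variable {K V : Type*} [Field K] [Finite K] [AddCommGroup V] [Module K V] [FiniteDimensional K V]

theorem finite_submodule (K V : Type*) [Field K] [Finite K] [AddCommGroup V] [Module K V]
    [FiniteDimensional K V] : Finite (Submodule K V) :=
  have : Finite V := Module.finite_of_finite K
  Finite.of_injective (fun S : Submodule K V => (S : Set V)) SetLike.coe_injective

/-- The number of `s`-dimensional subspaces of a subspace `A` is at most `|A| ^ s`. -/
theorem ncard_subspaces_le (A : Submodule K V) (s : ℕ) :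
    {P : Submodule K V | finrank K P = s ∧ P ≤ A}.ncard ≤ Nat.card K ^ (finrank K A * s) := by
  have : Finite V := Module.finite_of_finite K
  have hsub : {P : Submodule K V | finrank K P = s ∧ P ≤ A} ⊆
      Set.range fun f : Fin s → A => Submodule.span K (Set.range fun i => (f i : V)) := by
    rintro P ⟨rfl, hPA⟩
    let b := Module.finBasis K P
    refine ⟨fun i => ⟨b i, hPA (b i).2⟩, ?_⟩
    have := congrArg (Submodule.map P.subtype) b.span_eq
    rw [Submodule.map_span, Submodule.map_top, Submodule.range_subtype, ← Set.range_comp] at this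
    exact this
  have := finite_submodule K V
  calc _ ≤ _ := Set.ncard_le_ncard hsub (Set.toFinite _)
    _ ≤ Nat.card (Fin s → A) := by
        rw [← Nat.card_coe_set_eq]
        exact Finite.card_range_le _
    _ = Nat.card K ^ (finrank K A * s) := by
        rw [Nat.card_fun, Nat.card_fin, Module.natCard_eq_pow_finrank (K := K), pow_mul]

/-- Double counting of the pairs `(v, A)` with `v ∉ T` and `T ⊔ ⟨v⟩ ≤ A`. -/
theorem mul_ncard_subspacesAbove_succ_le {k N : ℕ} (T : Submodule K V)
    (hN : ∀ T' : Submodule K V, finrank K T' = finrank K T + 1 →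
      (subspacesAbove k T').ncard = N) :
    (Nat.card K ^ finrank K V - Nat.card K ^ finrank K T) * N ≤
      (subspacesAbove k T).ncard * Nat.card K ^ k := by
  classical
  have : Finite V := Module.finite_of_finite K
  have := finite_submodule K V
  have hs : ((T : Set V)ᶜ).Finite := Set.toFinite _
  have ht : (subspacesAbove k T).Finite := Set.toFinite _
  have key := Finset.card_mul_le_card_mul (s := hs.toFinset) (t := ht.toFinset)
    (fun (v : V) (A : Submodule K V) => v ∈ A) (m := N) (n := Nat.card K ^ k) ?_ ?_
  · rwa [← Set.ncard_eq_toFinset_card, ← Set.ncard_eq_toFinset_card, Set.ncard_compl,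
      ncard_submodule, Module.natCard_eq_pow_finrank (K := K) (V := V)] at key
  · intro v hv
    have hv : v ∉ T := by simpa using hv
    rw [← hN (T ⊔ Submodule.span K {v}) (Submodule.finrank_sup_span_singleton hv),
      ← Set.ncard_coe_finset]
    refine Set.ncard_le_ncard ?_ (Set.toFinite _)
    rintro A ⟨hA, hTA⟩
    simp only [Finset.coe_bipartiteAbove, Set.Finite.mem_toFinset, Set.mem_ofPred_eq]
    exact ⟨⟨hA, le_sup_left.trans hTA⟩,
      hTA (Submodule.mem_sup_right (Submodule.mem_span_singleton_self v))⟩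
  · intro A hA
    obtain ⟨hA, -⟩ : A ∈ subspacesAbove k T := by simpa using hA
    rw [← hA, ← ncard_submodule, ← Set.ncard_coe_finset]
    refine Set.ncard_le_ncard ?_ (Set.toFinite _)
    intro v hv
    simp only [Finset.coe_bipartiteBelow, Set.mem_ofPred_eq] at hv
    exact hv.2

/-- Few `k`-spaces above `T` contain one of the vectors of `U` outside `T`. -/
theorem ncard_subspacesAbove_meeting_le {k N : ℕ} {T U : Submodule K V}
    (hN : ∀ T' : Submodule K V, finrank K T' = finrank K T + 1 →
      (subspacesAbove k T').ncard = N) :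
    {A ∈ subspacesAbove k T | ∃ g ∈ U, g ∉ T ∧ g ∈ A}.ncard ≤ Nat.card K ^ finrank K U * N := by
  have : Finite V := Module.finite_of_finite K
  have := finite_submodule K V
  calc _ ≤ {g : V | g ∈ U ∧ g ∉ T}.ncard * N := by
        refine Set.ncard_le_ncard_mul (fun g => subspacesAbove k (T ⊔ Submodule.span K {g})) ?_ ?_
        · rintro A ⟨⟨hA, hTA⟩, g, hgU, hgT, hgA⟩
          exact ⟨g, ⟨hgU, hgT⟩, hA, sup_le hTA ((Submodule.span_singleton_le_iff_mem g A).2 hgA)⟩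
        · rintro g ⟨-, hgT⟩
          exact (hN _ (Submodule.finrank_sup_span_singleton hgT)).le
    _ ≤ _ := by
        rw [← ncard_submodule]
        exact Nat.mul_le_mul_right _ (Set.ncard_le_ncard (fun g hg => hg.1) (Set.toFinite _))

end Counting

/-! ### From wise intersection to pairwise intersection -/

section Intersecting

variable {K V : Type*} [Field K] [AddCommGroup V] [Module K V]

theorem IsWiseIntersecting.le_finrank_inf {p : ℕ} {F : Set (Submodule K V)}
    (hF : IsWiseIntersecting 2 p F) {A B : Submodule K V} (hA : A ∈ F) (hB : B ∈ F) :
    p ≤ finrank K (A ⊓ B : Submodule K V) := by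
  have := hF ![A, B] (by simp [Fin.forall_fin_two, hA, hB])
  rwa [show (⨅ i, ![A, B] i) = A ⊓ B from
    le_antisymm (le_inf (iInf_le _ 0) (iInf_le _ 1))
      (le_iInf (by simp [Fin.forall_fin_two]))] at this

theorem IsWiseIntersecting.mono {r t : ℕ} {F G : Set (Submodule K V)}
    (hG : IsWiseIntersecting r t G) (h : F ⊆ G) : IsWiseIntersecting r t F :=
  fun f hf => hG f fun i => h (hf i)

variable [FiniteDimensional K V]

/-- If `m` members met in a space of dimension at most `u`, every further member would still meet it
in dimension at least `u`, hence contain it, against `hcov`. -/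
theorem IsWiseIntersecting.of_succ {m u : ℕ} {F : Set (Submodule K V)}
    (hF : IsWiseIntersecting (m + 1) u F) (hne : F.Nonempty)
    (hcov : ∀ W : Submodule K V, u ≤ finrank K W → ∃ A ∈ F, ¬ W ≤ A) :
    IsWiseIntersecting m (u + 1) F := by
  intro f hf
  by_contra! h
  have key : ∀ G ∈ F, u ≤ finrank K (G ⊓ ⨅ i, f i : Submodule K V) := by
    intro G hG
    refine (hF (Fin.cons G f) fun i => ?_).trans (Submodule.finrank_mono ?_)
    · cases i using Fin.cases <;> simp [hG, hf]
    · exact le_inf (iInf_le_of_le 0 (by simp)) (le_iInf fun i => iInf_le_of_le i.succ (by simp))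
  obtain ⟨G, hG⟩ := hne
  obtain ⟨A, hA, hWA⟩ := hcov _ ((key G hG).trans (Submodule.finrank_mono inf_le_right))
  exact hWA (inf_eq_right.1
    (Submodule.eq_of_le_of_finrank_le inf_le_right (by have := key A hA; omega)))

theorem IsWiseIntersecting.two {m t : ℕ} {F : Set (Submodule K V)}
    (hF : IsWiseIntersecting (m + 2) t F) (hne : F.Nonempty)
    (hcov : ∀ W : Submodule K V, t ≤ finrank K W → ∃ A ∈ F, ¬ W ≤ A) :
    IsWiseIntersecting 2 (t + m) F := by
  induction m generalizing t with
  | zero => exact hF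
  | succ m ih =>
    have := ih (IsWiseIntersecting.of_succ hF hne hcov) fun W hW => hcov W (by omega)
    rwa [show t + (m + 1) = t + 1 + m by omega]

/-- No subspace of dimension at least `t` lies in all members of a family with a simplex. -/
theorem IsSimplex.exists_not_le {r t : ℕ} {S : Finset (Submodule K V)} (hS : IsSimplex r t S)
    {W : Submodule K V} (hW : t ≤ finrank K W) : ∃ A ∈ S, ¬ W ≤ A := by
  by_contra! h
  have := Submodule.finrank_mono (show W ≤ S.inf id from Finset.le_inf h)
  have := hS.2.2
  omega

/-- An `(r + 1)`-tuple from an `r`-wise `t`-intersecting family with small common intersection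
consists of distinct subspaces. -/
theorem IsWiseIntersecting.injective_of_finrank_lt {r t : ℕ} {F : Set (Submodule K V)}
    (hF : IsWiseIntersecting r t F) {f : Fin (r + 1) → Submodule K V} (hf : ∀ i, f i ∈ F)
    (h : finrank K (⨅ i, f i : Submodule K V) < t) : Function.Injective f := by
  intro i j hij
  by_contra hne
  -- With a repeated entry, dropping index `i` does not change the intersection, so `r` entries
  -- already give it dimension at least `t`.
  have h₁ := hF (fun l => f (i.succAbove l)) fun l => hf _
  have h₂ : (⨅ l, f (i.succAbove l)) ≤ ⨅ i, f i := by
    refine le_iInf fun a => ?_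
    by_cases ha : a = i
    · obtain ⟨l, hl⟩ := Fin.exists_succAbove_eq (Ne.symm hne)
      exact iInf_le_of_le l (by rw [hl, ha, hij])
    · obtain ⟨l, hl⟩ := Fin.exists_succAbove_eq ha
      exact iInf_le_of_le l (by rw [hl])
  have := Submodule.finrank_mono h₂
  omega

theorem IsWiseIntersecting.isSimplex_image [DecidableEq (Submodule K V)] {r t : ℕ}
    {F : Set (Submodule K V)} (hF : IsWiseIntersecting r t F) {f : Fin (r + 1) → Submodule K V}
    (hf : ∀ i, f i ∈ F) (h : finrank K (⨅ i, f i : Submodule K V) < t) :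
    (↑(Finset.univ.image f) : Set (Submodule K V)) ⊆ F ∧
      IsSimplex r t (Finset.univ.image f) := by
  have hsub : (↑(Finset.univ.image f) : Set (Submodule K V)) ⊆ F := by
    simpa [Set.range_subset_iff] using hf
  refine ⟨hsub, ?_, hF.mono hsub, ?_⟩
  · rw [Finset.card_image_of_injective _ (hF.injective_of_finrank_lt hf h), Finset.card_univ,
      Fintype.card_fin]
  · rwa [Finset.inf_image, Function.id_comp, Finset.inf_univ_eq_iInf]

end Intersecting

/-! ### Covering systems, light and heavy members -/

section Heavy

variable {K V : Type*} [Field K] [Finite K] [AddCommGroup V] [Module K V] [FiniteDimensional K V]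

/-- A small system of `(p + 1)`-spaces such that each member of a pairwise `p`-intersecting
`k`-uniform family without common `p`-space contains one of them. -/
theorem exists_covering_system {k p : ℕ} {F : Set (Submodule K V)} (hFk : IsUniformFamily k F)
    (hF : IsWiseIntersecting 2 p F)
    (hcov : ∀ P : Submodule K V, finrank K P = p → ∃ G ∈ F, ¬ P ≤ G) :
    ∃ C : Set (Submodule K V), (∀ T ∈ C, finrank K T = p + 1) ∧
      C.ncard ≤ Nat.card K ^ (k * (p + 1)) ∧ ∀ A ∈ F, ∃ T ∈ C, T ≤ A := by
  have : Finite V := Module.finite_of_finite K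
  have := finite_submodule K V
  rcases F.eq_empty_or_nonempty with rfl | ⟨A₁, hA₁⟩
  · exact ⟨∅, by simp⟩
  choose! G hGF hPG using hcov
  -- Each `p`-space `P` of one fixed member `A₁` is extended by a vector of a member `G P` not
  -- containing `P`: at most `q ^ (k * p)` choices of `P`, then `q ^ k` vectors.
  refine ⟨{T | ∃ P ∈ {P : Submodule K V | finrank K P = p ∧ P ≤ A₁},
    T ∈ (fun g => P ⊔ Submodule.span K {g}) '' {g : V | g ∈ G P ∧ g ∉ P}}, ?_, ?_, ?_⟩
  · rintro _ ⟨P, ⟨hP, -⟩, g, ⟨-, hg⟩, rfl⟩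
    rw [Submodule.finrank_sup_span_singleton hg, hP]
  · have hq : Nat.card K ^ (k * (p + 1)) = Nat.card K ^ (k * p) * Nat.card K ^ k := by ring
    rw [hq]
    refine (Set.ncard_le_ncard_mul (I := {P : Submodule K V | finrank K P = p ∧ P ≤ A₁})
      (fun P => (fun g => P ⊔ Submodule.span K {g}) '' {g : V | g ∈ G P ∧ g ∉ P})
      (fun T hT => hT) (m := Nat.card K ^ k) ?_).trans ?_
    · rintro P ⟨hP, -⟩
      refine (Set.ncard_image_le (Set.toFinite _)).trans ?_
      rw [← hFk _ (hGF P hP), ← ncard_submodule]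
      exact Set.ncard_le_ncard (fun g hg => hg.1) (Set.toFinite _)
    · rw [← hFk A₁ hA₁]
      exact Nat.mul_le_mul_right _ (ncard_subspaces_le A₁ p)
  · intro A hA
    obtain ⟨P, -, hPle, hP⟩ := exists_between_finrank_eq (bot_le : ⊥ ≤ A ⊓ A₁) (d := p) (by simp)
      (hF.le_finrank_inf hA hA₁)
    have hlt : finrank K (P ⊓ G P : Submodule K V) < finrank K (A ⊓ G P : Submodule K V) := by
      refine lt_of_lt_of_le ?_ (hF.le_finrank_inf hA (hGF P hP))
      by_contra! h
      exact hPG P hP (inf_eq_left.1 (Submodule.eq_of_le_of_finrank_le inf_le_left (by omega)))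
    obtain ⟨g, hgG, hgP, hgA⟩ := exists_mem_mem_notMem_of_finrank_inf_lt hlt
    exact ⟨_, ⟨P, ⟨hP, hPle.trans inf_le_right⟩, g, ⟨hgG, hgP⟩, rfl⟩,
      sup_le (hPle.trans inf_le_left) ((Submodule.span_singleton_le_iff_mem g A).2 hgA)⟩

/-- The members of `F` all of whose `s`-dimensional subspaces lie in at most `M` members. -/
def lightMembers (s M : ℕ) (F : Set (Submodule K V)) : Set (Submodule K V) :=
  {A ∈ F | ∀ T : Submodule K V, finrank K T = s → T ≤ A → {B ∈ F | T ≤ B}.ncard ≤ M}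

theorem ncard_le_of_covering_system {k s N : ℕ} {F C : Set (Submodule K V)}
    (hFk : IsUniformFamily k F) (hC : ∀ T ∈ C, finrank K T = s)
    (hFC : ∀ A ∈ F, ∃ T ∈ C, T ≤ A)
    (hN : ∀ T : Submodule K V, finrank K T = s → (subspacesAbove k T).ncard = N) :
    F.ncard ≤ C.ncard * N := by
  have := finite_submodule K V
  refine Set.ncard_le_ncard_mul (subspacesAbove k) (fun A hA => ?_) fun T hT => (hN T (hC T hT)).le
  obtain ⟨T, hT, hTA⟩ := hFC A hA
  exact ⟨T, hT, hFk A hA, hTA⟩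

/-- A space of `C` that lies below some light member lies, by lightness, in at most `M` members. -/
theorem ncard_lightMembers_le {s M : ℕ} {F C : Set (Submodule K V)}
    (hC : ∀ T ∈ C, finrank K T = s) (hFC : ∀ A ∈ F, ∃ T ∈ C, T ≤ A) :
    (lightMembers s M F).ncard ≤ C.ncard * M := by
  have := finite_submodule K V
  refine Set.ncard_le_ncard_mul (fun T => {A ∈ lightMembers s M F | T ≤ A}) ?_ ?_
  · intro A hA
    obtain ⟨T, hT, hTA⟩ := hFC A hA.1
    exact ⟨T, hT, hA, hTA⟩
  · intro T hT
    rcases Set.eq_empty_or_nonempty {A ∈ lightMembers s M F | T ≤ A} with h | ⟨A, hA, hTA⟩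
    · simp [h]
    · exact (Set.ncard_le_ncard (t := {B ∈ F | T ≤ B})
        (fun B hB => ⟨hB.1.1, hB.2⟩) (Set.toFinite _)).trans
        (hA.2 T (hC T hT) hTA)

/-- If `T` lies in many members of `F`, then it meets `U` as much as all members of `F` do. -/
theorem le_finrank_inf_of_heavy {k p N : ℕ} {F : Set (Submodule K V)} (hFk : IsUniformFamily k F)
    {T U : Submodule K V} (hU : finrank K U ≤ k)
    (hN : ∀ T' : Submodule K V, finrank K T' = finrank K T + 1 →
      (subspacesAbove k T').ncard = N)
    (hT : Nat.card K ^ k * N < {B ∈ F | T ≤ B}.ncard)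
    (hFU : ∀ A ∈ F, p ≤ finrank K (A ⊓ U : Submodule K V)) :
    p ≤ finrank K (T ⊓ U : Submodule K V) := by
  have := finite_submodule K V
  by_contra! h
  -- If `T ⊓ U` were too small, each member above `T` would need a vector of `U` outside `T`; this
  -- allows at most `q ^ k * N` members.
  have hsub : {B ∈ F | T ≤ B} ⊆ {A ∈ subspacesAbove k T | ∃ g ∈ U, g ∉ T ∧ g ∈ A} :=
    fun A ⟨hA, hTA⟩ => ⟨⟨hFk A hA, hTA⟩,
      exists_mem_mem_notMem_of_finrank_inf_lt (h.trans_le (hFU A hA))⟩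
  have h₁ := (Set.ncard_le_ncard hsub (Set.toFinite _)).trans (ncard_subspacesAbove_meeting_le hN)
  have h₂ : Nat.card K ^ finrank K U ≤ Nat.card K ^ k :=
    Nat.pow_le_pow_right Nat.card_pos hU
  exact absurd (h₁.trans (Nat.mul_le_mul_right N h₂)) (by omega)

/-- If some simplex of `F` has no light member, then `F` lies in a family `nearFamily X k`. -/
theorem exists_subset_nearFamily {k r t p N : ℕ} {F : Set (Submodule K V)} (htp : t ≤ p)
    (hpk : p + 1 ≤ k) (hFk : IsUniformFamily k F) (hF : IsWiseIntersecting 2 p F)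
    (hN : ∀ T' : Submodule K V, finrank K T' = p + 2 → (subspacesAbove k T').ncard = N)
    {S : Finset (Submodule K V)} (hS : IsSimplex r t S) (hSF : (S : Set (Submodule K V)) ⊆ F)
    (hlight : ∀ A ∈ S, A ∉ lightMembers (p + 1) (Nat.card K ^ k * N) F) :
    ∃ X : Submodule K V, finrank K X = p + 2 ∧ F ⊆ nearFamily X k := by
  have hT : ∀ A ∈ S, ∃ T : Submodule K V, finrank K T = p + 1 ∧ T ≤ A ∧
      Nat.card K ^ k * N < {B ∈ F | T ≤ B}.ncard := by
    intro A hA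
    by_contra! h
    exact hlight A hA ⟨hSF hA, h⟩
  choose! T hTp hTA hTM using hT
  have hgood : ∀ A ∈ S, ∀ G ∈ F, p ≤ finrank K (G ⊓ T A : Submodule K V) := by
    intro A hA G hG
    rw [inf_comm]
    refine le_finrank_inf_of_heavy hFk (hFk G hG).le ?_ (hTM A hA)
      fun B hB => hF.le_finrank_inf hB hG
    rw [hTp A hA]
    exact hN
  have hpair : ∀ A ∈ S, ∀ B ∈ S, p ≤ finrank K (T A ⊓ T B : Submodule K V) := by
    intro A hA B hB
    refine le_finrank_inf_of_heavy hFk (by rw [hTp B hB]; exact hpk) ?_ (hTM A hA) (hgood B hB)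
    rw [hTp A hA]
    exact hN
  obtain ⟨A₁, hA₁⟩ : S.Nonempty := Finset.card_pos.1 (by rw [hS.1]; omega)
  obtain ⟨A₂, hA₂, h₁₂⟩ := hS.exists_not_le (W := T A₁) (by rw [hTp A₁ hA₁]; omega)
  have hinf : finrank K (T A₁ ⊓ T A₂ : Submodule K V) = p := by
    refine le_antisymm ?_ (hpair A₁ hA₁ A₂ hA₂)
    by_contra! h
    refine h₁₂ (le_trans ?_ (hTA A₂ hA₂))
    rw [← Submodule.eq_of_le_of_finrank_le (inf_le_left : T A₁ ⊓ T A₂ ≤ T A₁)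
      (by rw [hTp A₁ hA₁]; exact h)]
    exact inf_le_right
  have hX : finrank K (T A₁ ⊔ T A₂ : Submodule K V) = p + 2 := by
    have := Submodule.finrank_sup_add_finrank_inf_eq (T A₁) (T A₂)
    rw [hinf, hTp A₁ hA₁, hTp A₂ hA₂] at this
    omega
  -- A third heavy space, not containing `T A₁ ⊓ T A₂`, excludes the second alternative of
  -- `finrank_inf_sup_or_inf_sup_eq`: first for itself, so it lies in `X`, then for every member
  -- `G`, since otherwise `G ⊓ T A₃` would equal `T A₁ ⊓ T A₂`.
  obtain ⟨A₃, hA₃, h₃⟩ := hS.exists_not_le (W := T A₁ ⊓ T A₂) (by omega)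
  have h₃ : ¬ T A₁ ⊓ T A₂ ≤ T A₃ := fun h => h₃ (h.trans (hTA A₃ hA₃))
  have hT₃ : T A₃ ≤ T A₁ ⊔ T A₂ := by
    rcases finrank_inf_sup_or_inf_sup_eq hinf (hpair A₃ hA₃ A₁ hA₁) (hpair A₃ hA₃ A₂ hA₂) with h | h
    · rw [← Submodule.eq_of_le_of_finrank_le (inf_le_left : T A₃ ⊓ (T A₁ ⊔ T A₂) ≤ T A₃)
        (by rw [hTp A₃ hA₃]; exact h)]
      exact inf_le_right
    · exact absurd (h ▸ inf_le_left) h₃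
  refine ⟨T A₁ ⊔ T A₂, hX, fun G hG => ⟨hFk G hG, ?_⟩⟩
  rw [hX]
  rcases finrank_inf_sup_or_inf_sup_eq hinf (hgood A₁ hA₁ G hG) (hgood A₂ hA₂ G hG) with h | h
  · omega
  · have h₄ : G ⊓ T A₃ ≤ T A₁ ⊓ T A₂ := h ▸ inf_le_inf_left G hT₃
    have h₅ := Submodule.eq_of_le_of_finrank_le h₄ (by rw [hinf]; exact hgood A₃ hA₃ G hG)
    exact absurd (h₅ ▸ inf_le_right) h₃

/-- If every simplex of `F` has a member in `B`, then `F` has at most `|B| |F| ^ r` simplices. -/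
theorem simplexCount_le_of_mem {r t : ℕ} {F B : Set (Submodule K V)}
    (h : ∀ S : Finset (Submodule K V), (S : Set (Submodule K V)) ⊆ F → IsSimplex r t S →
      ∃ A ∈ S, A ∈ B) :
    simplexCount r t F ≤ B.ncard * F.ncard ^ r := by
  classical
  have := finite_submodule K V
  have hsub : {S : Finset (Submodule K V) | (S : Set (Submodule K V)) ⊆ F ∧ IsSimplex r t S} ⊆
      Set.range fun x : B × (Fin r → F) =>
        insert (x.1 : Submodule K V) (Finset.univ.image fun i => (x.2 i : Submodule K V)) := by
    rintro S ⟨hSF, hS⟩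
    obtain ⟨A, hAS, hAB⟩ := h S hSF hS
    have hcard : (S.erase A).card = r := by rw [Finset.card_erase_of_mem hAS, hS.1]; rfl
    let e := (S.erase A).equivFinOfCardEq hcard
    refine ⟨(⟨A, hAB⟩, fun i => ⟨e.symm i, hSF (Finset.mem_of_mem_erase (e.symm i).2)⟩), ?_⟩
    have : (Finset.univ.image fun i => ((e.symm i : S.erase A) : Submodule K V)) = S.erase A := by
      ext C
      simp only [Finset.mem_image, Finset.mem_univ, true_and]
      constructor
      · rintro ⟨i, rfl⟩
        exact (e.symm i).2
      · intro hC
        exact ⟨e ⟨C, hC⟩, by simp⟩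
    simp only [this]
    exact Finset.insert_erase hAS
  calc simplexCount r t F ≤ _ := Set.ncard_le_ncard hsub (Set.toFinite _)
    _ ≤ Nat.card (B × (Fin r → F)) := by
        rw [← Nat.card_coe_set_eq]
        exact Finite.card_range_le _
    _ = B.ncard * F.ncard ^ r := by
        rw [Nat.card_prod, Nat.card_fun, Nat.card_fin, Nat.card_coe_set_eq, Nat.card_coe_set_eq]

end Heavy

/-! ### Structure of the extremal families -/

section NearFamily

variable {K V : Type*} [Field K] [AddCommGroup V] [Module K V] [FiniteDimensional K V]

/-- Each member cuts the trace on `X` by at most one dimension. -/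
theorem finrank_le_finrank_inf_add_card {k : ℕ} {X : Submodule K V} (S : Finset (Submodule K V))
    (hS : (S : Set (Submodule K V)) ⊆ nearFamily X k) :
    finrank K X ≤ finrank K (S.inf id ⊓ X : Submodule K V) + S.card := by
  classical
  induction S using Finset.induction_on with
  | empty => exact (Submodule.finrank_mono (le_inf le_top le_rfl)).trans (Nat.le_add_right _ _)
  | insert A S hA ih =>
    rw [Finset.coe_insert, Set.insert_subset_iff] at hS
    have h₁ := ih hS.2
    have h₂ := hS.1.2
    rw [Finset.card_insert_of_notMem hA, Finset.inf_insert, id]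
    have h₃ := Submodule.finrank_sup_add_finrank_inf_eq (A ⊓ X) (S.inf id ⊓ X)
    rw [← inf_inf_distrib_right] at h₃
    have h₄ := Submodule.finrank_mono (show A ⊓ X ⊔ S.inf id ⊓ X ≤ X from
      sup_le inf_le_right inf_le_right)
    omega

theorem nearFamily_isWiseIntersecting {k r t : ℕ} {X : Submodule K V}
    (hX : finrank K X = r + t) : IsWiseIntersecting r t (nearFamily X k) := by
  classical
  intro f hf
  have h := finrank_le_finrank_inf_add_card (X := X) (k := k) (Finset.univ.image f)
    (by simpa [Set.range_subset_iff] using hf)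
  have hc : (Finset.univ.image f).card ≤ r := Finset.card_image_le.trans (by simp)
  have hi := Submodule.finrank_mono
    (inf_le_left : (Finset.univ.image f).inf id ⊓ X ≤ (Finset.univ.image f).inf id)
  rw [Finset.inf_image, Function.id_comp, Finset.inf_univ_eq_iInf] at h hi
  change t ≤ finrank K (iInf f : Submodule K V)
  omega

/-- A member containing `X` cuts nothing from it, while the other `r` members leave at least `t`
dimensions of `X`. -/
theorem IsSimplex.mem_nearFamilyStar {k r t : ℕ} {X : Submodule K V} (hX : finrank K X = r + t)
    {S : Finset (Submodule K V)} (hS : IsSimplex r t S)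
    (hSX : (S : Set (Submodule K V)) ⊆ nearFamily X k) {A : Submodule K V} (hA : A ∈ S) :
    A ∈ nearFamilyStar X k := by
  classical
  obtain ⟨hAk, hAX⟩ := hSX hA
  refine ⟨hAk, ?_⟩
  by_contra h
  have hXA : X ≤ A := inf_eq_right.1
    (Submodule.eq_of_le_of_finrank_le (inf_le_right : A ⊓ X ≤ X) (by omega))
  have h₁ := finrank_le_finrank_inf_add_card (S.erase A)
    (fun B hB => hSX (Finset.mem_of_mem_erase hB))
  rw [Finset.card_erase_of_mem hA, hS.1] at h₁
  have h₂ : (S.erase A).inf id ⊓ X ≤ S.inf id := by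
    rw [← Finset.insert_erase hA, Finset.inf_insert, Finset.erase_insert_eq_erase,
      Finset.erase_idem, inf_comm]
    exact inf_le_inf_right _ hXA
  have := Submodule.finrank_mono h₂
  have := hS.2.2
  omega

theorem simplexCount_eq_of_between {k r t : ℕ} {X : Submodule K V} (hX : finrank K X = r + t)
    {F : Set (Submodule K V)} (h₁ : nearFamilyStar X k ⊆ F) (h₂ : F ⊆ nearFamily X k) :
    simplexCount r t F = simplexCount r t (nearFamily X k) := by
  unfold simplexCount
  congr 1
  ext S
  exact ⟨fun ⟨h, hS⟩ => ⟨h.trans h₂, hS⟩,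
    fun ⟨h, hS⟩ => ⟨fun A hA => h₁ (hS.mem_nearFamilyStar hX h hA), hS⟩⟩

/-- Hyperplanes of `X` that together with a given hyperplane are in general position. -/
theorem exists_hyperplanes {X H₀ : Submodule K V} (hH₀ : H₀ ≤ X)
    (hd : finrank K H₀ + 1 = finrank K X) (m : ℕ) (hm : m + 1 ≤ finrank K X) :
    ∃ H : Fin m → Submodule K V, (∀ i, H i ≤ X) ∧ (∀ i, finrank K (H i) + 1 = finrank K X) ∧
      finrank K (H₀ ⊓ ⨅ i, H i : Submodule K V) + (m + 1) ≤ finrank K X := by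
  induction m with
  | zero => exact ⟨Fin.elim0, fun i => i.elim0, fun i => i.elim0, by
    have := Submodule.finrank_mono (inf_le_left : (H₀ ⊓ ⨅ i : Fin 0, i.elim0) ≤ H₀)
    omega⟩
  | succ m ih =>
    obtain ⟨H, hHX, hHd, hH⟩ := ih (by omega)
    set W := H₀ ⊓ ⨅ i, H i with hW
    obtain ⟨H', hH'X, hH'd, hH'⟩ : ∃ H' ≤ X, finrank K H' + 1 = finrank K X ∧
        finrank K (H' ⊓ W : Submodule K V) + (m + 2) ≤ finrank K X := by
      -- Once the intersection is zero, any hyperplane will do, so `H₀` is reused.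
      by_cases h : finrank K W = 0
      · refine ⟨H₀, hH₀, hd, ?_⟩
        have := Submodule.finrank_mono (inf_le_right : H₀ ⊓ W ≤ W)
        omega
      · obtain ⟨w, hwW, hw⟩ := Submodule.exists_mem_ne_zero_of_ne_bot
          (show W ≠ ⊥ by rintro hb; rw [hb, finrank_bot] at h; exact h rfl)
        obtain ⟨H', hH'X, hH'd, hwH'⟩ := exists_hyperplane_notMem (hH₀ (hwW.1 : w ∈ H₀)) hw
        refine ⟨H', hH'X, hH'd, ?_⟩
        have : H' ⊓ W < W := lt_of_le_of_ne inf_le_right fun h => hwH' (inf_eq_right.1 h hwW)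
        have := Submodule.finrank_lt_finrank_of_lt this
        omega
    refine ⟨Fin.cons H' H, ?_, ?_, ?_⟩
    · exact fun i => Fin.cases hH'X hHX i
    · exact fun i => Fin.cases hH'd hHd i
    · refine le_trans (Nat.add_le_add_right (Submodule.finrank_mono ?_) _) hH'
      refine le_inf (inf_le_right.trans (iInf_le_of_le 0 le_rfl))
        (inf_le_inf_left H₀ (le_iInf fun i => iInf_le_of_le i.succ le_rfl))

/-- The `k`-spaces above `H` that meet `Y` in `H` only. -/
def subspacesMeetingIn (k : ℕ) (H Y : Submodule K V) : Set (Submodule K V) :=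
  {A ∈ subspacesAbove k H | A ⊓ Y ≤ H}

/-- The traces on `X` recover the hyperplanes, so the order of a tuple can be read off from its set
of entries. -/
theorem cons_inf_eq {K V : Type*} [Field K] [AddCommGroup V] [Module K V] {k r : ℕ}
    {X H₀ : Submodule K V} {H : Fin r → Submodule K V} (hH₀X : H₀ ≤ X) (hHX : ∀ i, H i ≤ X)
    {A₀ : Submodule K V} (hA₀ : A₀ ∈ subspacesMeetingIn k H₀ X) {A : Fin r → Submodule K V}
    (hA : ∀ i, A i ∈ subspacesMeetingIn k (H i) (A₀ ⊔ X)) (i : Fin (r + 1)) :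
    (Fin.cons A₀ A : Fin (r + 1) → Submodule K V) i ⊓ X =
      (Fin.cons H₀ H : Fin (r + 1) → Submodule K V) i := by
  cases i using Fin.cases with
  | zero => exact le_antisymm hA₀.2 (le_inf hA₀.1.2 hH₀X)
  | succ i =>
    exact le_antisymm ((inf_le_inf_left _ le_sup_right).trans (hA i).2)
      (le_inf (hA i).1.2 (hHX i))

variable {k r t : ℕ} {X H₀ : Submodule K V} {H : Fin r → Submodule K V}

/-- Subspaces meeting `X` in general hyperplanes, one of them chosen generically with respect to
the first, have a small common intersection. -/
theorem finrank_iInf_cons_lt (hr : 1 ≤ r)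
    (hH : finrank K (H₀ ⊓ ⨅ i, H i : Submodule K V) < t) (hHX : ∀ i, H i ≤ X)
    {A₀ : Submodule K V} (hA₀ : A₀ ∈ subspacesMeetingIn k H₀ X) {A : Fin r → Submodule K V}
    (hA : ∀ i, A i ∈ subspacesMeetingIn k (H i) (A₀ ⊔ X)) :
    finrank K (⨅ i, (Fin.cons A₀ A : Fin (r + 1) → Submodule K V) i : Submodule K V) < t := by
  refine (Submodule.finrank_mono ?_).trans_lt hH
  have h₀ : (⨅ i, (Fin.cons A₀ A : Fin (r + 1) → Submodule K V) i) ≤ A₀ :=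
    iInf_le_of_le 0 le_rfl
  -- The intersection lies in `A₀ ⊔ X`, where `A i` reduces to `H i`. It therefore lies in `X`,
  -- where `A₀` reduces to `H₀`.
  have h₁ : ∀ i, (⨅ i, (Fin.cons A₀ A : Fin (r + 1) → Submodule K V) i) ≤ H i := fun i =>
    (le_inf (iInf_le_of_le i.succ le_rfl) (h₀.trans le_sup_left)).trans (hA i).2
  exact le_inf ((le_inf h₀ ((h₁ ⟨0, hr⟩).trans (hHX _))).trans hA₀.2) (le_iInf h₁)

theorem cons_mem_nearFamily (hd₀ : finrank K H₀ + 1 = finrank K X) (hH₀X : H₀ ≤ X)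
    (hd : ∀ i, finrank K (H i) + 1 = finrank K X) (hHX : ∀ i, H i ≤ X)
    {A₀ : Submodule K V} (hA₀ : A₀ ∈ subspacesMeetingIn k H₀ X) {A : Fin r → Submodule K V}
    (hA : ∀ i, A i ∈ subspacesMeetingIn k (H i) (A₀ ⊔ X)) (i : Fin (r + 1)) :
    (Fin.cons A₀ A : Fin (r + 1) → Submodule K V) i ∈ nearFamily X k := by
  cases i using Fin.cases with
  | zero =>
    refine ⟨hA₀.1.1, ?_⟩
    rw [← hd₀]
    exact Nat.add_le_add_right (Submodule.finrank_mono (le_inf hA₀.1.2 hH₀X)) 1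
  | succ i =>
    refine ⟨(hA i).1.1, ?_⟩
    rw [← hd i]
    exact Nat.add_le_add_right (Submodule.finrank_mono (le_inf (hA i).1.2 (hHX i))) 1

/-- The hyperplanes themselves belong to `nearFamily X (r + t - 1)`, so the distinctness criterion
for tuples applies to them. -/
theorem injective_cons_hyperplanes (hX : finrank K X = r + t)
    (hd₀ : finrank K H₀ + 1 = finrank K X) (hH₀X : H₀ ≤ X)
    (hd : ∀ i, finrank K (H i) + 1 = finrank K X) (hHX : ∀ i, H i ≤ X)
    (hH : finrank K (H₀ ⊓ ⨅ i, H i : Submodule K V) < t) :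
    Function.Injective (Fin.cons H₀ H : Fin (r + 1) → Submodule K V) := by
  refine (nearFamily_isWiseIntersecting (k := r + t - 1) hX).injective_of_finrank_lt (fun i => ?_)
    ((Submodule.finrank_mono ?_).trans_lt hH)
  · cases i using Fin.cases with
    | zero =>
      change H₀ ∈ nearFamily X (r + t - 1)
      exact ⟨by omega, by rw [inf_eq_left.2 hH₀X, hd₀]⟩
    | succ i =>
      change H i ∈ nearFamily X (r + t - 1)
      have := hd i
      exact ⟨by omega, by rw [inf_eq_left.2 (hHX i), hd i]⟩
  · exact le_inf (iInf_le_of_le 0 le_rfl) (le_iInf fun i => iInf_le_of_le i.succ le_rfl)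

theorem finrank_sup_le_of_mem_nearFamily {A : Submodule K V} (hA : A ∈ nearFamily X k) :
    finrank K (A ⊔ X : Submodule K V) ≤ k + 1 := by
  have h := Submodule.finrank_sup_add_finrank_inf_eq A X
  have h₁ := hA.1
  have h₂ := hA.2
  omega

end NearFamily

/-! ### Simplices in the extremal families -/

section NearFamilyCount

variable {K V : Type*} [Field K] [Finite K] [AddCommGroup V] [Module K V] [FiniteDimensional K V]
variable {k r t N₁ N₂ : ℕ} {X : Submodule K V}

theorem le_ncard_subspacesMeetingIn {d : ℕ} {H Y : Submodule K V} (hY : finrank K Y ≤ d)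
    (hN₁ : (subspacesAbove k H).ncard = N₁)
    (hN₂ : ∀ T : Submodule K V, finrank K T = finrank K H + 1 →
      (subspacesAbove k T).ncard = N₂) :
    N₁ - Nat.card K ^ d * N₂ ≤ (subspacesMeetingIn k H Y).ncard := by
  have := finite_submodule K V
  have hsub : subspacesAbove k H ⊆ subspacesMeetingIn k H Y ∪
      {A ∈ subspacesAbove k H | ∃ g ∈ Y, g ∉ H ∧ g ∈ A} := by
    intro A hA
    by_cases h : A ⊓ Y ≤ H
    · exact Or.inl ⟨hA, h⟩
    · obtain ⟨g, hg, hgH⟩ := SetLike.not_le_iff_exists.1 h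
      exact Or.inr ⟨hA, g, hg.2, hgH, hg.1⟩
  have h₁ := (Set.ncard_le_ncard hsub (Set.toFinite _)).trans (Set.ncard_union_le _ _)
  have h₂ := ncard_subspacesAbove_meeting_le (U := Y) hN₂
  have h₃ : Nat.card K ^ finrank K Y * N₂ ≤ Nat.card K ^ d * N₂ :=
    Nat.mul_le_mul_right _ (Nat.pow_le_pow_right Nat.card_pos hY)
  omega

/-- The trace `A₀ ⊓ X` is completed to hyperplanes in general position, and each new one is lifted
to a `k`-space meeting `A₀ ⊔ X` only there. As `A₀ ⊔ X` has dimension at most `k + 1`, `hN` leaves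
such a lift. -/
theorem exists_simplex_of_mem_nearFamilyStar (hX : finrank K X = r + t) (ht : 1 ≤ t) (hr : 1 ≤ r)
    (hN₁ : ∀ T : Submodule K V, finrank K T + 1 = r + t → (subspacesAbove k T).ncard = N₁)
    (hN₂ : ∀ T : Submodule K V, finrank K T = r + t → (subspacesAbove k T).ncard = N₂)
    (hN : Nat.card K ^ (k + 1) * N₂ < N₁) {A₀ : Submodule K V} (hA₀ : A₀ ∈ nearFamilyStar X k) :
    ∃ S : Finset (Submodule K V), A₀ ∈ S ∧ (S : Set (Submodule K V)) ⊆ nearFamily X k ∧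
      IsSimplex r t S := by
  classical
  obtain ⟨hA₀k, hA₀X⟩ := hA₀
  obtain ⟨H, hHX, hd, hH⟩ := exists_hyperplanes (H₀ := A₀ ⊓ X) inf_le_right hA₀X r (by omega)
  have hne : ∀ i, (subspacesMeetingIn k (H i) (A₀ ⊔ X)).Nonempty := fun i => by
    have hdi := hd i
    refine Set.nonempty_of_ncard_ne_zero ?_
    have := le_ncard_subspacesMeetingIn (k := k) (H := H i)
      (finrank_sup_le_of_mem_nearFamily (k := k) ⟨hA₀k, hA₀X.ge⟩) (hN₁ (H i) (by omega))
      (fun T hT => hN₂ T (by omega))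
    omega
  choose A hA using hne
  have hA₀' : A₀ ∈ subspacesMeetingIn k (A₀ ⊓ X) X := ⟨⟨hA₀k, inf_le_left⟩, le_rfl⟩
  refine ⟨Finset.univ.image (Fin.cons A₀ A : Fin (r + 1) → Submodule K V),
    Finset.mem_image.2 ⟨0, by simp⟩, ?_⟩
  exact (nearFamily_isWiseIntersecting hX).isSimplex_image
    (cons_mem_nearFamily hA₀X inf_le_right hd hHX hA₀' hA)
    (finrank_iInf_cons_lt hr (by omega) hHX hA₀' hA)

/-- One fixed system of hyperplanes in general position suffices: each of the `r + 1` lifts has at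
least `N₁ - q ^ (k + 1) * N₂` choices, and different choices give different simplices. -/
theorem pow_le_simplexCount_nearFamily (hX : finrank K X = r + t) (ht : 1 ≤ t) (hr : 1 ≤ r)
    (hk : r + t ≤ k + 1)
    (hN₁ : ∀ T : Submodule K V, finrank K T + 1 = r + t → (subspacesAbove k T).ncard = N₁)
    (hN₂ : ∀ T : Submodule K V, finrank K T = r + t → (subspacesAbove k T).ncard = N₂) :
    (N₁ - Nat.card K ^ (k + 1) * N₂) ^ (r + 1) ≤ simplexCount r t (nearFamily X k) := by
  classical
  have := finite_submodule K V
  obtain ⟨H₀, -, hH₀X, hd₀⟩ := exists_between_finrank_eq (bot_le : ⊥ ≤ X) (d := r + t - 1)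
    (by simp) (by omega)
  have hd₀ : finrank K H₀ + 1 = finrank K X := by omega
  obtain ⟨H, hHX, hd, hH⟩ := exists_hyperplanes hH₀X hd₀ r (by omega)
  have hH : finrank K (H₀ ⊓ ⨅ i, H i : Submodule K V) < t := by omega
  let M := N₁ - Nat.card K ^ (k + 1) * N₂
  let Ω := Σ A₀ : subspacesMeetingIn k H₀ X,
    ∀ i : Fin r, subspacesMeetingIn k (H i) ((A₀ : Submodule K V) ⊔ X)
  have hnear : ∀ ω : Ω, ∀ i, (Fin.cons ω.1.1 (fun i => (ω.2 i).1) :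
      Fin (r + 1) → Submodule K V) i ∈ nearFamily X k := fun ω =>
    cons_mem_nearFamily hd₀ hH₀X hd hHX ω.1.2 fun i => (ω.2 i).2
  have hΩ : M ^ (r + 1) ≤ Nat.card Ω := by
    have := Fintype.ofFinite (subspacesMeetingIn k H₀ X)
    have h₀ : M ≤ Fintype.card (subspacesMeetingIn k H₀ X) := by
      rw [← Nat.card_eq_fintype_card, Nat.card_coe_set_eq]
      exact le_ncard_subspacesMeetingIn (by omega) (hN₁ H₀ (by omega))
        fun T hT => hN₂ T (by omega)
    have h₁ : ∀ A₀ : subspacesMeetingIn k H₀ X, M ^ r ≤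
        Nat.card (∀ i : Fin r, subspacesMeetingIn k (H i) ((A₀ : Submodule K V) ⊔ X)) := by
      intro A₀
      rw [Nat.card_pi, ← Fin.prod_const]
      refine Finset.prod_le_prod' fun i _ => ?_
      have hdi := hd i
      rw [Nat.card_coe_set_eq]
      refine le_ncard_subspacesMeetingIn (finrank_sup_le_of_mem_nearFamily ⟨A₀.2.1.1, ?_⟩)
        (hN₁ (H i) (by omega)) fun T hT => hN₂ T (by omega)
      rw [← hd₀]
      exact Nat.add_le_add_right (Submodule.finrank_mono (le_inf A₀.2.1.2 hH₀X)) 1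
    rw [Nat.card_sigma, pow_succ']
    calc M * M ^ r ≤ Fintype.card (subspacesMeetingIn k H₀ X) * M ^ r :=
          Nat.mul_le_mul_right _ h₀
      _ = ∑ A₀ : subspacesMeetingIn k H₀ X, M ^ r := by simp
      _ ≤ _ := Finset.sum_le_sum fun A₀ _ => h₁ A₀
  refine hΩ.trans ?_
  unfold simplexCount
  rw [← Nat.card_coe_set_eq]
  refine Nat.card_le_card_of_injective (fun ω : Ω => ⟨Finset.univ.image
    (Fin.cons ω.1.1 (fun i => (ω.2 i).1) : Fin (r + 1) → Submodule K V),
    (nearFamily_isWiseIntersecting hX).isSimplex_image (hnear ω)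
      (finrank_iInf_cons_lt hr hH hHX ω.1.2 fun i => (ω.2 i).2)⟩) ?_
  intro ω ω' h
  have h := congrArg Subtype.val h
  simp only at h
  have heq : ∀ i, (Fin.cons ω.1.1 (fun i => (ω.2 i).1) : Fin (r + 1) → Submodule K V) i =
      (Fin.cons ω'.1.1 (fun i => (ω'.2 i).1) : Fin (r + 1) → Submodule K V) i := by
    intro i
    have hi := Finset.mem_image_of_mem
      (Fin.cons ω.1.1 (fun i => (ω.2 i).1) : Fin (r + 1) → Submodule K V) (Finset.mem_univ i)
    rw [h] at hi
    obtain ⟨j, -, hj⟩ := Finset.mem_image.1 hi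
    have hij := congrArg (fun B : Submodule K V => B ⊓ X) hj
    beta_reduce at hij
    rw [cons_inf_eq hH₀X hHX ω.1.2 fun i => (ω.2 i).2,
      cons_inf_eq hH₀X hHX ω'.1.2 fun i => (ω'.2 i).2] at hij
    rw [← hj, injective_cons_hyperplanes hX hd₀ hH₀X hd hHX hH hij]
  obtain ⟨⟨A₀, hA₀⟩, A⟩ := ω
  obtain ⟨⟨A₀', hA₀'⟩, A'⟩ := ω'
  obtain rfl : A₀ = A₀' := by simpa using heq 0
  congr 1
  funext i
  exact Subtype.ext (by simpa using heq i.succ)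

theorem simplexCount_nearFamily_le {X X' : Submodule K V} (hX : finrank K X = r + t)
    (hX' : finrank K X' = r + t) :
    simplexCount r t (nearFamily X k) ≤ simplexCount r t (nearFamily X' k) := by
  classical
  have := finite_submodule K V
  obtain ⟨e, rfl⟩ := exists_linearEquiv_map_eq (hX.trans hX'.symm)
  let φ : Submodule K V ≃o Submodule K V := Submodule.orderIsoMapComap e
  have hφ : ∀ A : Submodule K V, finrank K (φ A) = finrank K A := fun A =>
    LinearEquiv.finrank_map_eq e A
  refine Set.ncard_le_ncard_of_injOn (fun S => S.image φ) ?_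
    (Finset.image_injective φ.injective).injOn (Set.toFinite _)
  rintro S ⟨hSX, hS⟩
  have hsub : ((S.image φ : Finset (Submodule K V)) : Set (Submodule K V)) ⊆
      nearFamily (X.map (e : V →ₗ[K] V)) k := by
    rw [Finset.coe_image]
    rintro _ ⟨A, hA, rfl⟩
    obtain ⟨hAk, hAX⟩ := hSX hA
    refine ⟨(hφ A).trans hAk, ?_⟩
    change _ ≤ finrank K (φ A ⊓ φ X : Submodule K V) + 1
    rwa [← map_inf, hφ, hX', ← hX]
  refine ⟨hsub, ?_, (nearFamily_isWiseIntersecting hX').mono hsub, ?_⟩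
  · rw [Finset.card_image_of_injective _ φ.injective, hS.1]
  · rw [Finset.inf_image, Function.id_comp]
    have : S.inf φ = φ (S.inf id) := (map_finset_inf φ S id).symm
    rw [this, hφ]
    exact hS.2.2

end NearFamilyCount

/-! ### The numerical estimate -/

/-- Double counting gives `q ^ (n - 1 - k) * N₂ ≤ N₁`. Hence the subtracted term is at most half of
`N₁`; the resulting factor `2 ^ (r + 1)` is absorbed into `q ^ (r + 1)`, and one factor `N₂`
outweighs all powers of `q`. -/
theorem light_mul_pow_lt {q n k r t N₁ N₂ L M : ℕ} (hq : 2 ≤ q) (ht : 1 ≤ t) (hr : 2 ≤ r)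
    (hk : r + t - 1 ≤ k) (hn : 3 * k * r ^ 2 + 3 * k * r * t ≤ n) (hN₁ : 1 ≤ N₁)
    (hN : (q ^ n - q ^ (r + t - 1)) * N₂ ≤ N₁ * q ^ k)
    (hL : L ≤ q ^ (k * (r + t - 1)) * (q ^ k * N₂)) (hM : M ≤ q ^ (k * (r + t - 1)) * N₁) :
    q ^ (k + 1) * N₂ < N₁ ∧ L * M ^ r < (N₁ - q ^ (k + 1) * N₂) ^ (r + 1) := by
  obtain ⟨s, hs⟩ : ∃ s, r + t = s + 1 := ⟨r + t - 1, by omega⟩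
  have hs' : r + t - 1 = s := by omega
  rw [hs'] at hk hN hL hM
  -- This is all that is needed of `n`: the exponent in `hlt`, plus one for strictness, is at most
  -- `n - 1 - k`.
  have hn' : r + 3 + 2 * k + k * s + k * s * r ≤ n := by
    refine le_trans ?_ hn
    have h₁ : 3 * k * r ^ 2 + 3 * k * r * t = 3 * (k * r * s) + 3 * (k * r) := by
      have : r * r + r * t = r * s + r := by rw [← mul_add, hs]; ring
      calc _ = 3 * k * (r * r + r * t) := by ring
        _ = _ := by rw [this]; ring
    rw [h₁]
    have h₂ : k * s ≤ k * r * s := by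
      calc k * s = k * 1 * s := by ring
        _ ≤ k * r * s := by gcongr; omega
    have h₃ : k * 2 ≤ k * r := by gcongr
    have h₄ : 2 * r ≤ k * r := by gcongr; omega
    have h₅ : k * s * r = k * r * s := by ring
    omega
  have hq0 : 0 < q := by omega
  have hNE : q ^ (n - 1 - k) * N₂ ≤ N₁ := by
    refine Nat.le_of_mul_le_mul_right ?_ (pow_pos hq0 k)
    refine le_trans ?_ hN
    have h₁ : q ^ (n - 1 - k) * N₂ * q ^ k = q ^ (n - 1) * N₂ := by
      rw [mul_right_comm, ← pow_add, Nat.sub_add_cancel (by omega)]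
    rw [h₁]
    refine Nat.mul_le_mul_right _ ?_
    have h₂ : q ^ s ≤ q ^ (n - 1) := Nat.pow_le_pow_right hq0 (by omega)
    have h₃ : q ^ n = q ^ (n - 1) * q := by rw [← pow_succ, Nat.sub_add_cancel (by omega)]
    have h₄ : q ^ (n - 1) * 2 ≤ q ^ (n - 1) * q := Nat.mul_le_mul_left _ hq
    omega
  have hpow : ∀ e, e ≤ n - 1 - k → q ^ e * N₂ ≤ N₁ := fun e he =>
    (Nat.mul_le_mul_right _ (Nat.pow_le_pow_right hq0 he)).trans hNE
  have hhalf : 2 * (q ^ (k + 1) * N₂) ≤ N₁ := by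
    refine le_trans ?_ (hpow (k + 2) (by omega))
    rw [pow_succ q (k + 1), mul_comm (q ^ (k + 1)) q, mul_assoc]
    exact Nat.mul_le_mul_right _ hq
  have hlt : q ^ (r + 1 + k * s + k + k * s * r) * N₂ < N₁ := by
    -- `N₂` vanishes when `k = r + t - 1`; strictness then comes from `N₁` being positive.
    rcases Nat.eq_zero_or_pos N₂ with h | h
    · rw [h, mul_zero]; exact hN₁
    · refine lt_of_lt_of_le ?_ (hpow (r + 1 + k * s + k + k * s * r + 1) (by omega))
      exact Nat.mul_lt_mul_of_pos_right (Nat.pow_lt_pow_right hq (Nat.lt_succ_self _)) h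
  refine ⟨by omega, ?_⟩
  have h2 : N₁ ≤ 2 * (N₁ - q ^ (k + 1) * N₂) := by omega
  refine lt_of_mul_lt_mul_left (a := 2 ^ (r + 1)) ?_ (Nat.zero_le _)
  rw [← mul_pow]
  refine lt_of_lt_of_le ?_ (Nat.pow_le_pow_left h2 (r + 1))
  calc 2 ^ (r + 1) * (L * M ^ r)
      ≤ q ^ (r + 1) * (q ^ (k * s) * (q ^ k * N₂) * (q ^ (k * s) * N₁) ^ r) := by gcongr
    _ = q ^ (r + 1 + k * s + k + k * s * r) * N₂ * N₁ ^ r := by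
        rw [mul_pow, ← pow_mul]
        ring
    _ < N₁ * N₁ ^ r := Nat.mul_lt_mul_of_pos_right hlt (by positivity)
    _ = N₁ ^ (r + 1) := (pow_succ' N₁ r).symm

/-! ### The main theorem -/

theorem theorem1p1 {K V : Type*} [Field K] [Finite K] [AddCommGroup V] [Module K V]
    [FiniteDimensional K V] (n k r t : ℕ) (hV : finrank K V = n)
    (ht : 1 ≤ t) (hr : 2 ≤ r) (hk : r + t - 1 ≤ k)
    (hn : 3 * k * r ^ 2 + 3 * k * r * t ≤ n)
    (F : Set (Submodule K V)) (hFk : IsUniformFamily k F) (hF : IsWiseIntersecting r t F) :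
    (∃ X₀ : Submodule K V, finrank K X₀ = r + t) ∧
    ∀ X₀ : Submodule K V, finrank K X₀ = r + t →
      simplexCount r t F ≤ simplexCount r t (nearFamily X₀ k) ∧
      (simplexCount r t F = simplexCount r t (nearFamily X₀ k) ↔
        ∃ X : Submodule K V, finrank K X = r + t ∧
          nearFamilyStar X k ⊆ F ∧ F ⊆ nearFamily X k) := by
  have := finite_submodule K V
  have hkn : k + 1 ≤ n ∧ r + t ≤ n := by
    have h₁ : 3 * k * r ^ 2 ≥ 3 * k := Nat.le_mul_of_pos_right _ (by positivity)
    omega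
  have hex : ∀ d ≤ n, ∃ T : Submodule K V, finrank K T = d := fun d hd => by
    obtain ⟨T, -, -, hT⟩ := exists_between_finrank_eq (bot_le : ⊥ ≤ (⊤ : Submodule K V)) (d := d)
      (by simp) (by rw [finrank_top, hV]; exact hd)
    exact ⟨T, hT⟩
  obtain ⟨X₁, hX₁⟩ := hex (r + t) hkn.2
  refine ⟨⟨X₁, hX₁⟩, ?_⟩
  intro X₀ hX₀
  obtain ⟨T₁, hT₁⟩ := hex (r + t - 1) (by omega)
  have hN₁ : ∀ T : Submodule K V, finrank K T + 1 = r + t →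
      (subspacesAbove k T).ncard = (subspacesAbove k T₁).ncard := fun T hT =>
    ncard_subspacesAbove_eq k (by omega)
  have hN₂ : ∀ T : Submodule K V, finrank K T = r + t →
      (subspacesAbove k T).ncard = (subspacesAbove k X₀).ncard := fun T hT =>
    ncard_subspacesAbove_eq k (by omega)
  set N₁ := (subspacesAbove k T₁).ncard
  set N₂ := (subspacesAbove k X₀).ncard
  have hN₁pos : 1 ≤ N₁ := by
    obtain ⟨A, hTA, -, hA⟩ := exists_between_finrank_eq (le_top : T₁ ≤ ⊤) (d := k) (by omega)
      (by rw [finrank_top]; omega)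
    exact (Set.ncard_pos (Set.toFinite _)).2 ⟨A, hA, hTA⟩
  have hN := mul_ncard_subspacesAbove_succ_le (k := k) (N := N₂) T₁ fun T hT => hN₂ T (by omega)
  rw [hV, hT₁] at hN
  have hq : 2 ≤ Nat.card K := Finite.one_lt_card
  have hinv : ∀ X : Submodule K V, finrank K X = r + t →
      simplexCount r t (nearFamily X k) = simplexCount r t (nearFamily X₀ k) := fun X hX =>
    le_antisymm (simplexCount_nearFamily_le hX hX₀) (simplexCount_nearFamily_le hX₀ hX)
  have hlow := pow_le_simplexCount_nearFamily hX₀ ht (by omega) (by omega) hN₁ hN₂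
  -- Only the first conclusion is wanted, so `L = M = 0` serve.
  have hgap : Nat.card K ^ (k + 1) * N₂ < N₁ :=
    (light_mul_pow_lt hq ht hr hk hn hN₁pos hN (Nat.zero_le _) (Nat.zero_le _)).1
  have hmain : simplexCount r t F < simplexCount r t (nearFamily X₀ k) ∨
      ∃ X : Submodule K V, finrank K X = r + t ∧ F ⊆ nearFamily X k := by
    by_cases hS : ∃ S : Finset (Submodule K V), (S : Set (Submodule K V)) ⊆ F ∧ IsSimplex r t S
    · obtain ⟨S₀, hS₀F, hS₀⟩ := hS
      have hcov : ∀ W : Submodule K V, t ≤ finrank K W → ∃ A ∈ F, ¬ W ≤ A := fun W hW => by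
        obtain ⟨A, hA, h⟩ := hS₀.exists_not_le hW
        exact ⟨A, hS₀F hA, h⟩
      -- From here on `p` is `t + m`.
      obtain ⟨m, rfl⟩ : ∃ m, r = m + 2 := ⟨r - 2, by omega⟩
      obtain ⟨A, hA, -⟩ := hS₀.exists_not_le (W := X₀) (by omega)
      have hpair := hF.two ⟨A, hS₀F hA⟩ hcov
      obtain ⟨C, hC, hCcard, hFC⟩ := exists_covering_system hFk hpair
        fun P hP => hcov P (by omega)
      by_cases hlight : ∃ S : Finset (Submodule K V), (S : Set (Submodule K V)) ⊆ F ∧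
          IsSimplex (m + 2) t S ∧
          ∀ A ∈ S, A ∉ lightMembers (t + m + 1) (Nat.card K ^ k * N₂) F
      · right
        obtain ⟨S, hSF, hS, hl⟩ := hlight
        obtain ⟨X, hX, hFX⟩ := exists_subset_nearFamily (Nat.le_add_right t m) (by omega) hFk hpair
          (fun T hT => hN₂ T (by omega)) hS hSF hl
        exact ⟨X, by omega, hFX⟩
      · left
        push Not at hlight
        have hs : t + m + 1 = m + 2 + t - 1 := by omega
        have hFcard := (ncard_le_of_covering_system hFk hC hFC
          (fun T hT => hN₁ T (by omega))).trans (Nat.mul_le_mul_right _ hCcard)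
        have hLcard := (ncard_lightMembers_le (M := Nat.card K ^ k * N₂) hC hFC).trans
          (Nat.mul_le_mul_right _ hCcard)
        rw [hs] at hFcard hLcard
        have hcount := simplexCount_le_of_mem (F := F) (r := m + 2) (t := t) hlight
        rw [hs] at hcount
        exact hcount.trans_lt
          ((light_mul_pow_lt hq ht hr hk hn hN₁pos hN hLcard hFcard).2.trans_le hlow)
    · left
      have h₀ : simplexCount r t F = 0 := by
        unfold simplexCount
        rw [Set.ncard_eq_zero (Set.toFinite _), Set.eq_empty_iff_forall_notMem]
        exact fun S hS' => hS ⟨S, hS'⟩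
      rw [h₀]
      exact (pow_pos (Nat.sub_pos_of_lt hgap) _).trans_le hlow
  have hmono : ∀ X : Submodule K V, F ⊆ nearFamily X k →
      {S : Finset (Submodule K V) | (S : Set (Submodule K V)) ⊆ F ∧ IsSimplex r t S} ⊆
      {S : Finset (Submodule K V) | (S : Set (Submodule K V)) ⊆ nearFamily X k ∧
        IsSimplex r t S} := fun X hFX S hS => ⟨hS.1.trans hFX, hS.2⟩
  refine ⟨?_, ?_, ?_⟩
  · rcases hmain with h | ⟨X, hX, hFX⟩
    · exact h.le
    · rw [← hinv X hX]
      exact Set.ncard_le_ncard (hmono X hFX) (Set.toFinite _)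
  · intro heq
    rcases hmain with h | ⟨X, hX, hFX⟩
    · exact absurd heq h.ne
    · refine ⟨X, hX, fun A hA => ?_, hFX⟩
      obtain ⟨S, hAS, hSX, hS⟩ := exists_simplex_of_mem_nearFamilyStar hX ht (by omega) hN₁ hN₂
        hgap hA
      rw [← hinv X hX] at heq
      -- Equal counts force every simplex of `nearFamily X k` to lie in `F`, in particular the one
      -- through `A`.
      have hset := Set.eq_of_subset_of_ncard_le (hmono X hFX) heq.ge (Set.toFinite _)
      exact (hset.ge ⟨hSX, hS⟩).1 hAS
  · rintro ⟨X, hX, h₁, h₂⟩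
    rw [← hinv X hX]
    exact simplexCount_eq_of_between hX h₁ h₂
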